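/- Let $d>1$ be an integer and let $\mathcal H_1,\dots,\mathcal H_d$ be separable Hilbert spaces (over $\mathbb R$ or over $\mathbb C$), with Hilbert space tensor product $\mathcal H=\bigotimes_{j=1}^d\mathcal H_j$. Sequences are indexed by countable sets. A sequence $(f_n)$ in a Hilbert space $K$ is a *frame* for $K$ if there are constants $A,B>0$ with $A\|f\|^2\le\sum_n|\langle f,f_n\rangle|^2\le B\|f\|^2$ for all $f\in K$. It is a *Riesz basis* for $K$ if it is a frame that is the image of an orthonormal basis of $K$ (with the same index set) under a continuous invertible linear map of $K$ onto itself. For each $j\in\{1,\dots,d\}$ let $I_j$ be a countable index set (for instance $I_j=\mathbb N$) and let $(f_{j,1,n})_{n\in I_j}$ and $(f_{j,2,n})_{n\in I_j}$ be two sequences in $\mathcal H_j$ that are linearly independent as elements of the vector space $\mathcal H_j^{I_j}$ of all sequences. For $k=1,2$ let $$\mathcal F_k=\Big(\bigotimes_{j=1}^d f_{j,k,n_j}\Big)_{(n_1,\dots,n_d)\in I_1\times\cdots\times I_d},\qquad \mathcal F=\mathcal F_1+\mathcal F_2=\Big(\bigotimes_{j=1}^d f_{j,1,n_j}+\bigotimes_{j=1}^d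 f_{j,2,n_j}\Big)_{(n_1,\dots,n_d)}.$$ (i) If $\mathcal F$ is a frame for $\mathcal H$, then $\mathcal F_1$ is a frame for $\mathcal H$, or $\mathcal F_2$ is a frame for $\mathcal H$, or there is an index $i\in\{1,\dots,d\}$ such that $(f_{j,k,n})_{n\in I_j}$ is a frame for $\mathcal H_j$ for every $j\ne i$ and every $k\in\{1,2\}$. (ii) If $\mathcal F$ is a Riesz basis for $\mathcal H$ and $(f_{j,k,n})_{n\in I_j}$ is a frame for $\mathcal H_j$ for all $j\in\{1,\dots,d\}$ and $k\in\{1,2\}$, then $\mathcal F_1$ is a Riesz basis for $\mathcal H$, or $\mathcal F_2$ is a Riesz basis for $\mathcal H$, or there is an index $i\in\{1,\dots,d\}$ such that $(f_{j,k,n})_{n\in I_j}$ is a Riesz basis for $\mathcal H_j$ for every $j\ne i$ and every $k\in\{1,2\}$. -/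

import Mathlib

/-! ### Frames and Riesz bases -/

/-- A family `f` in an inner product space is a frame if there are constants `A, B > 0` with
`A ‖x‖² ≤ ∑ₙ |⟨x, fₙ⟩|² ≤ B ‖x‖²` for all `x`, the series being convergent. -/
def IsFrame (𝕜 : Type*) [RCLike 𝕜] {H ι : Type*} [NormedAddCommGroup H] [InnerProductSpace 𝕜 H]
    (f : ι → H) : Prop :=
  ∃ A B : ℝ, 0 < A ∧ 0 < B ∧ ∀ x : H,
    Summable (fun n => ‖inner 𝕜 (f n) x‖ ^ 2) ∧
      A * ‖x‖ ^ 2 ≤ ∑' n, ‖inner 𝕜 (f n) x‖ ^ 2 ∧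
      ∑' n, ‖inner 𝕜 (f n) x‖ ^ 2 ≤ B * ‖x‖ ^ 2

/-- A family `f` is a Riesz basis if it is a frame and it is the image of an orthonormal
(Hilbert) basis under a continuous invertible linear map of the space onto itself. -/
def IsRieszBasis (𝕜 : Type*) [RCLike 𝕜] {H ι : Type*} [NormedAddCommGroup H]
    [InnerProductSpace 𝕜 H] (f : ι → H) : Prop :=
  IsFrame 𝕜 f ∧ ∃ (e : HilbertBasis ι 𝕜 H) (T : H ≃L[𝕜] H), ∀ n, f n = T (e n)

/-! ### The Hilbert space tensor product of finitely many inner product spaces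

It is the completion of the algebraic tensor product with respect to the inner product determined
by `⟨⨂ xⱼ, ⨂ yⱼ⟩ = ∏ ⟨xⱼ, yⱼ⟩`. -/

open scoped TensorProduct ComplexOrder

/-- The algebraic tensor product, to be equipped with the tensor inner product (Mathlib equips
`⨂[𝕜] j, H j` itself with the projective seminorm, hence the type synonym). -/
def AlgTensor (𝕜 : Type*) [RCLike 𝕜] {κ : Type*} (H : κ → Type*)
    [∀ j, NormedAddCommGroup (H j)] [∀ j, InnerProductSpace 𝕜 (H j)] : Type _ :=
  ⨂[𝕜] j, H j

namespace AlgTensor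

variable (𝕜 : Type*) [RCLike 𝕜] {κ : Type*} (H : κ → Type*)
  [∀ j, NormedAddCommGroup (H j)] [∀ j, InnerProductSpace 𝕜 (H j)]

instance instAddCommGroup : AddCommGroup (AlgTensor 𝕜 H) :=
  inferInstanceAs (AddCommGroup (PiTensorProduct 𝕜 H))

instance instModule : Module 𝕜 (AlgTensor 𝕜 H) :=
  inferInstanceAs (Module 𝕜 (PiTensorProduct 𝕜 H))

variable {H}

/-- Algebraic elementary tensors `⨂ xⱼ`. -/
def tprod (x : ∀ j, H j) : AlgTensor 𝕜 H := PiTensorProduct.tprod 𝕜 x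

variable {𝕜} in
theorem induction {p : AlgTensor 𝕜 H → Prop} (htprod : ∀ (r : 𝕜) (x : ∀ j, H j), p (r • tprod 𝕜 x))
    (hadd : ∀ u v, p u → p v → p (u + v)) (z : AlgTensor 𝕜 H) : p z :=
  PiTensorProduct.induction_on (motive := p) z htprod hadd

variable {𝕜} in
theorem exists_sum (z : AlgTensor 𝕜 H) :
    ∃ (n : ℕ) (c : Fin n → 𝕜) (x : Fin n → ∀ j, H j), z = ∑ a, c a • tprod 𝕜 (x a) := by
  induction z using AlgTensor.induction with
  | htprod r x => exact ⟨1, fun _ => r, fun _ => x, by simp⟩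
  | hadd u v hu hv =>
    obtain ⟨n, c, x, rfl⟩ := hu
    obtain ⟨m, c', x', rfl⟩ := hv
    exact ⟨n + m, Fin.append c c', Fin.append x x', by simp [Fin.sum_univ_add]⟩

variable [Fintype κ]

/-- The linear form `⨂ yⱼ ↦ ∏ ⟨xⱼ, yⱼ⟩`. -/
noncomputable def form (x : ∀ j, H j) : AlgTensor 𝕜 H →ₗ[𝕜] 𝕜 :=
  PiTensorProduct.lift
    ((MultilinearMap.mkPiAlgebra 𝕜 κ 𝕜).compLinearMap fun j => (innerₛₗ 𝕜 (x j)))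

variable {𝕜} in
theorem form_tprod (x y : ∀ j, H j) : form 𝕜 x (tprod 𝕜 y) = ∏ j, inner 𝕜 (x j) (y j) := by
  simp only [form, tprod]
  erw [PiTensorProduct.lift.tprod]
  simp

/-- The multilinear map `x ↦ conj (form x ·)`. -/
noncomputable def conjForm : MultilinearMap 𝕜 H (AlgTensor 𝕜 H → 𝕜) where
  toFun x := fun z => starRingEnd 𝕜 (form 𝕜 x z)
  map_update_add' {inst} x i a b := by
    funext z
    classical
    obtain rfl : inst = fun a b => Classical.propDecidable _ := Subsingleton.elim _ _
    induction z using AlgTensor.induction with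
    | htprod r y =>
      simp only [map_smul, smul_eq_mul, form_tprod, map_mul, map_prod, Pi.add_apply]
      rw [← mul_add]
      congr 1
      simp only [← Finset.mul_prod_erase Finset.univ _ (Finset.mem_univ i), Function.update_self,
        inner_add_left, map_add, add_mul]
      congr 2 <;>
      · refine Finset.prod_congr rfl fun j hj => ?_
        rw [Function.update_of_ne (Finset.ne_of_mem_erase hj),
          Function.update_of_ne (Finset.ne_of_mem_erase hj)]
    | hadd u v hu hv =>
      simp only [map_add, Pi.add_apply] at hu hv ⊢
      rw [hu, hv]; ring
  map_update_smul' {inst} x i c a := by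
    funext z
    classical
    obtain rfl : inst = fun a b => Classical.propDecidable _ := Subsingleton.elim _ _
    induction z using AlgTensor.induction with
    | htprod r y =>
      simp only [map_smul, smul_eq_mul, form_tprod, map_mul, map_prod, Pi.smul_apply]
      rw [mul_left_comm]
      congr 1
      simp only [← Finset.mul_prod_erase Finset.univ _ (Finset.mem_univ i), Function.update_self,
        inner_smul_left, map_mul, RCLike.conj_conj, mul_assoc]
      congr 2
      refine Finset.prod_congr rfl fun j hj => ?_
      rw [Function.update_of_ne (Finset.ne_of_mem_erase hj),
        Function.update_of_ne (Finset.ne_of_mem_erase hj)]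
    | hadd u v hu hv =>
      simp only [map_add, Pi.smul_apply, smul_eq_mul] at hu hv ⊢
      rw [hu, hv]; ring

/-- The inner product on the algebraic tensor product, conjugate linear in the first variable. -/
noncomputable instance instInner : Inner 𝕜 (AlgTensor 𝕜 H) where
  inner u v := starRingEnd 𝕜 (PiTensorProduct.lift (conjForm 𝕜) u v)

variable {𝕜}

theorem inner_add_left' (u v w : AlgTensor 𝕜 H) :
    inner 𝕜 (u + v) w = inner 𝕜 u w + inner 𝕜 v w := by
  change starRingEnd 𝕜 (PiTensorProduct.lift (conjForm 𝕜) (_ + _) w) = _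
  erw [map_add]
  simp [inner]

theorem inner_smul_left' (c : 𝕜) (u w : AlgTensor 𝕜 H) :
    inner 𝕜 (c • u) w = starRingEnd 𝕜 c * inner 𝕜 u w := by
  change starRingEnd 𝕜 (PiTensorProduct.lift (conjForm 𝕜) (_ • _) w) = _
  erw [map_smul]
  simp [inner]

theorem inner_tprod_left (x : ∀ j, H j) (w : AlgTensor 𝕜 H) :
    inner 𝕜 (tprod 𝕜 x) w = form 𝕜 x w := by
  change starRingEnd 𝕜 (PiTensorProduct.lift (conjForm 𝕜) (PiTensorProduct.tprod 𝕜 x) w) = _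
  rw [PiTensorProduct.lift.tprod]
  exact RCLike.conj_conj _

/-- The defining formula `⟨⨂ xⱼ, ⨂ yⱼ⟩ = ∏ ⟨xⱼ, yⱼ⟩`. -/
theorem inner_tprod_tprod (x y : ∀ j, H j) :
    inner 𝕜 (tprod 𝕜 x) (tprod 𝕜 y) = ∏ j, inner 𝕜 (x j) (y j) := by
  rw [inner_tprod_left, form_tprod]

theorem inner_add_right' (u v w : AlgTensor 𝕜 H) :
    inner 𝕜 u (v + w) = inner 𝕜 u v + inner 𝕜 u w := by
  induction u using AlgTensor.induction with
  | htprod r x => simp only [inner_smul_left', inner_tprod_left, map_add, mul_add]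
  | hadd a b ha hb => rw [inner_add_left', inner_add_left', inner_add_left', ha, hb]; ring

theorem inner_smul_right' (c : 𝕜) (u v : AlgTensor 𝕜 H) :
    inner 𝕜 u (c • v) = c * inner 𝕜 u v := by
  induction u using AlgTensor.induction with
  | htprod r x => simp only [inner_smul_left', inner_tprod_left, map_smul, smul_eq_mul]; ring
  | hadd a b ha hb => rw [inner_add_left', inner_add_left', ha, hb]; ring

theorem conj_inner_symm' (u v : AlgTensor 𝕜 H) :
    starRingEnd 𝕜 (inner 𝕜 v u) = inner 𝕜 u v := by
  induction u using AlgTensor.induction with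
  | htprod r x =>
    induction v using AlgTensor.induction with
    | htprod s y =>
      simp only [inner_smul_left', inner_smul_right', inner_tprod_tprod, map_mul, map_prod,
        RCLike.conj_conj, inner_conj_symm]
      ring
    | hadd a b ha hb => rw [inner_add_left', inner_add_right', map_add, ha, hb]
  | hadd a b ha hb => rw [inner_add_left', inner_add_right', map_add, ha, hb]

theorem posSemidef_gram {n : Type*} [Fintype n] (x : n → ∀ j, H j) :
    (Matrix.of fun a b => ∏ j, inner 𝕜 (x a j) (x b j)).PosSemidef := by
  classical
  suffices h : ∀ s : Finset κ,
      (Matrix.of fun a b => ∏ j ∈ s, inner 𝕜 (x a j) (x b j)).PosSemidef from h _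
  intro s
  induction s using Finset.induction_on with
  | empty =>
    convert Matrix.posSemidef_gram 𝕜 (fun _ : n => (1 : 𝕜)) using 1
    ext a b
    simp [Matrix.gram]
  | insert i s hi ih =>
    have h := (Matrix.posSemidef_gram 𝕜 (fun a => x a i)).hadamard ih
    convert h using 1
    ext a b
    simp [Matrix.gram, Finset.prod_insert hi]

theorem re_inner_nonneg' (z : AlgTensor 𝕜 H) : 0 ≤ RCLike.re (inner 𝕜 z z) := by
  obtain ⟨n, c, x, rfl⟩ := exists_sum z
  have hl : ∀ (s : Finset (Fin n)) (w : AlgTensor 𝕜 H),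
      inner 𝕜 (∑ a ∈ s, c a • tprod 𝕜 (x a)) w =
        ∑ a ∈ s, starRingEnd 𝕜 (c a) * inner 𝕜 (tprod 𝕜 (x a)) w := by
    intro s w
    induction s using Finset.cons_induction with
    | empty => simpa using inner_smul_left' (0 : 𝕜) (0 : AlgTensor 𝕜 H) w
    | cons a s ha ih => rw [Finset.sum_cons, Finset.sum_cons, inner_add_left', inner_smul_left', ih]
  have h := (posSemidef_gram (𝕜 := 𝕜) x).dotProduct_mulVec_nonneg c
  rw [hl]
  simp only [inner_tprod_left, map_sum, map_smul, form_tprod, smul_eq_mul]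
  convert (RCLike.nonneg_iff.mp h).1 using 1
  simp only [dotProduct, Matrix.mulVec, Matrix.of_apply, map_sum, Pi.star_apply, RCLike.star_def,
    Finset.mul_sum]
  refine Finset.sum_congr rfl fun a _ => Finset.sum_congr rfl fun b _ => ?_
  congr 1; ring

variable (𝕜 H)

/-- The tensor inner product as a positive semidefinite Hermitian form. -/
@[reducible] noncomputable def core : PreInnerProductSpace.Core 𝕜 (AlgTensor 𝕜 H) where
  conj_inner_symm := conj_inner_symm'
  re_inner_nonneg := re_inner_nonneg'
  add_left := inner_add_left'
  smul_left u w c := inner_smul_left' c u w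

noncomputable instance instSeminormedAddCommGroup : SeminormedAddCommGroup (AlgTensor 𝕜 H) :=
  @InnerProductSpace.Core.toSeminormedAddCommGroup 𝕜 _ _ _ _ (core 𝕜 H)

noncomputable instance instInnerProductSpace : InnerProductSpace 𝕜 (AlgTensor 𝕜 H) :=
  InnerProductSpace.ofCore (core 𝕜 H)

end AlgTensor

/-- The Hilbert space tensor product `⨂ⱼ H j`: the completion of the algebraic tensor product for
the inner product with `⟨⨂ xⱼ, ⨂ yⱼ⟩ = ∏ ⟨xⱼ, yⱼ⟩`. -/
abbrev HilbertTensor (𝕜 : Type*) [RCLike 𝕜] {κ : Type*} [Fintype κ] (H : κ → Type*)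
    [∀ j, NormedAddCommGroup (H j)] [∀ j, InnerProductSpace 𝕜 (H j)] : Type _ :=
  UniformSpace.Completion (AlgTensor 𝕜 H)

namespace HilbertTensor

variable (𝕜 : Type*) [RCLike 𝕜] {κ : Type*} [Fintype κ] {H : κ → Type*}
  [∀ j, NormedAddCommGroup (H j)] [∀ j, InnerProductSpace 𝕜 (H j)]

/-- The elementary tensor `⨂ xⱼ` in the Hilbert space tensor product. -/
noncomputable def tprod (x : ∀ j, H j) : HilbertTensor 𝕜 H :=
  ((AlgTensor.tprod 𝕜 x : AlgTensor 𝕜 H) : UniformSpace.Completion (AlgTensor 𝕜 H))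

theorem inner_tprod_tprod (x y : ∀ j, H j) :
    inner 𝕜 (tprod 𝕜 x) (tprod 𝕜 y) = ∏ j, inner 𝕜 (x j) (y j) := by
  rw [tprod, tprod, UniformSpace.Completion.inner_coe, AlgTensor.inner_tprod_tprod]

end HilbertTensor

/-- The tensor product of the families `f j : ι j → H j`, indexed by multi-indices
`n = (n j)ⱼ`: the family `n ↦ ⨂ⱼ f j (n j)`. -/
noncomputable def tensorFamily (𝕜 : Type*) [RCLike 𝕜] {κ : Type*} [Fintype κ] {H : κ → Type*}
    [∀ j, NormedAddCommGroup (H j)] [∀ j, InnerProductSpace 𝕜 (H j)] {ι : κ → Type*}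
    (f : ∀ j, ι j → H j) : (∀ j, ι j) → HilbertTensor 𝕜 H :=
  fun n => HilbertTensor.tprod 𝕜 fun j => f j (n j)

/-! Write `f j`, `g j` for the two families in slot `j`, with synthesis operators `T j`, `S j` on
`ℓ²`. The synthesis operator of the sum is `W = ⨂ T j + ⨂ S j`, and its adjoint sends `⨂ x j` to `⨂
(T j)* x j + ⨂ (S j)* x j`. If `f i` and `g l` both fail to be frames and `i ≠ l`, one elementary
tensor can carry a unit vector nearly killed by `(T i)*` in slot `i` and one nearly killed by `(S
l)*` in slot `l`. Both summands are then small, against the lower frame bound. So `f i` or `g l` is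
a frame whenever `i ≠ l`, and a combinatorial argument gives the three alternatives, since tensor
products of frames are frames.

The synthesis operators exist only once every factor is Bessel. This comes from slicing: freezing
all slots but one gives Bessel combinations `a • f i + b • g i`, and independence in another slot
makes the pairs `(a, b)` span `𝕜 × 𝕜`.

For Riesz bases `W` is injective, and exact kernel vectors of `T i` and `S l` replace the
approximate ones. -/

/-! ### Norm bound for algebraic tensor products of operators -/

/-- With `z = ∑ a, c a • x a`, the quadratic form at `c` is `‖T‖² ‖z‖² - ‖T z‖²`. -/
theorem Matrix.posSemidef_smul_gram_sub_gram_map {𝕜 : Type*} [RCLike 𝕜] {E F n : Type*}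
    [NormedAddCommGroup E] [InnerProductSpace 𝕜 E] [NormedAddCommGroup F] [InnerProductSpace 𝕜 F]
    [Fintype n] (T : E →L[𝕜] F) (x : n → E) :
    (Matrix.of fun a b => ((‖T‖ ^ 2 : ℝ) : 𝕜) * inner 𝕜 (x a) (x b)
      - inner 𝕜 (T (x a)) (T (x b))).PosSemidef := by
  refine Matrix.PosSemidef.of_dotProduct_mulVec_nonneg ?_ fun c => ?_
  · ext a b
    simp [Matrix.conjTranspose_apply, inner_conj_symm]
  · have h : star c ⬝ᵥ ((Matrix.of fun a b => ((‖T‖ ^ 2 : ℝ) : 𝕜) * inner 𝕜 (x a) (x b)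
        - inner 𝕜 (T (x a)) (T (x b))).mulVec c)
        = ((‖T‖ ^ 2 * ‖∑ a, c a • x a‖ ^ 2 - ‖T (∑ a, c a • x a)‖ ^ 2 : ℝ) : 𝕜) := by
      push_cast
      rw [← inner_self_eq_norm_sq_to_K (𝕜 := 𝕜) (∑ a, c a • x a),
        ← inner_self_eq_norm_sq_to_K (𝕜 := 𝕜) (T _)]
      simp only [map_sum, map_smul, sum_inner, inner_sum, inner_smul_left, inner_smul_right,
        dotProduct, Matrix.mulVec, Matrix.of_apply, Finset.mul_sum, ← Finset.sum_sub_distrib,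
        Pi.star_apply, RCLike.star_def]
      rw [Finset.sum_comm]
      refine Finset.sum_congr rfl fun a _ => Finset.sum_congr rfl fun b _ => ?_
      ring
    rw [h, RCLike.ofReal_nonneg, ← mul_pow, sub_nonneg]
    gcongr
    exact T.le_opNorm _

namespace AlgTensor

variable {𝕜 : Type*} [RCLike 𝕜] {κ : Type*} {H K : κ → Type*}
  [∀ j, NormedAddCommGroup (H j)] [∀ j, InnerProductSpace 𝕜 (H j)]
  [∀ j, NormedAddCommGroup (K j)] [∀ j, InnerProductSpace 𝕜 (K j)]

/-- The algebraic tensor product of linear maps. -/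
noncomputable def mapₗ (T : ∀ j, H j →L[𝕜] K j) : AlgTensor 𝕜 H →ₗ[𝕜] AlgTensor 𝕜 K :=
  PiTensorProduct.map fun j => (T j : H j →ₗ[𝕜] K j)

theorem mapₗ_tprod (T : ∀ j, H j →L[𝕜] K j) (x : ∀ j, H j) :
    mapₗ T (tprod 𝕜 x) = tprod 𝕜 fun j => T j (x j) :=
  PiTensorProduct.map_tprod _ _

variable [Fintype κ]

/-- Schur's product theorem and induction on the slots, through `tG∘P - G'∘P' = tG∘(P - P') + (tG -
G')∘P'` for Hadamard products. Positivity of `P'` has to be carried along. -/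
theorem posSemidef_gram_sub_gram_map {n : Type*} [Fintype n] (T : ∀ j, H j →L[𝕜] K j)
    (x : n → ∀ j, H j) :
    (Matrix.of fun a b => ∏ j, (((‖T j‖ ^ 2 : ℝ) : 𝕜) * inner 𝕜 (x a j) (x b j))
      - ∏ j, inner 𝕜 (T j (x a j)) (T j (x b j))).PosSemidef := by
  classical
  suffices h : ∀ s : Finset κ,
      (Matrix.of fun a b => ∏ j ∈ s, (((‖T j‖ ^ 2 : ℝ) : 𝕜) * inner 𝕜 (x a j) (x b j))
      - ∏ j ∈ s, inner 𝕜 (T j (x a j)) (T j (x b j))).PosSemidef ∧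
      (Matrix.of fun a b => ∏ j ∈ s, inner 𝕜 (T j (x a j)) (T j (x b j))).PosSemidef from (h _).1
  intro s
  induction s using Finset.induction_on with
  | empty =>
    refine ⟨?_, ?_⟩
    · convert Matrix.PosSemidef.zero (n := n) (R := 𝕜) using 1
      ext a b
      simp
    · convert Matrix.posSemidef_gram 𝕜 (fun _ : n => (1 : 𝕜)) using 1
      ext a b
      simp [Matrix.gram]
  | insert i s hi ih =>
    obtain ⟨ih₁, ih₂⟩ := ih
    have h₁ := Matrix.posSemidef_smul_gram_sub_gram_map (T i) (fun a => x a i)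
    have h₂ := Matrix.posSemidef_gram 𝕜 (fun a => x a i)
    have h₃ := Matrix.posSemidef_gram 𝕜 (fun a => T i (x a i))
    have h₄ : (0 : 𝕜) ≤ ((‖T i‖ ^ 2 : ℝ) : 𝕜) := by
      rw [RCLike.ofReal_nonneg]; positivity
    refine ⟨?_, ?_⟩
    · convert ((h₂.smul h₄).hadamard ih₁).add (h₁.hadamard ih₂) using 1
      ext a b
      simp only [Matrix.gram, Finset.prod_insert hi, Matrix.of_apply, Matrix.add_apply,
        Matrix.hadamard_apply, Matrix.smul_apply, smul_eq_mul]
      ring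
    · convert h₃.hadamard ih₂ using 1
      ext a b
      simp [Matrix.gram, Finset.prod_insert hi]

theorem norm_sum_sq {n : ℕ} (c : Fin n → 𝕜) (x : Fin n → ∀ j, H j) :
    ((‖∑ a, c a • tprod 𝕜 (x a)‖ ^ 2 : ℝ) : 𝕜) =
      star c ⬝ᵥ ((Matrix.of fun a b => ∏ j, inner 𝕜 (x a j) (x b j)).mulVec c) := by
  push_cast
  rw [← inner_self_eq_norm_sq_to_K (𝕜 := 𝕜)]
  simp only [sum_inner, inner_sum, inner_smul_left, inner_smul_right, inner_tprod_tprod,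
    dotProduct, Matrix.mulVec, Matrix.of_apply, Finset.mul_sum, Pi.star_apply, RCLike.star_def]
  rw [Finset.sum_comm]
  refine Finset.sum_congr rfl fun a _ => Finset.sum_congr rfl fun b _ => ?_
  ring

/-- The difference of the squares of the two sides is the quadratic form of
`posSemidef_gram_sub_gram_map`. The bound on all of `AlgTensor 𝕜 H` is what lets the map extend to
the completion. -/
theorem norm_mapₗ_le (T : ∀ j, H j →L[𝕜] K j) (z : AlgTensor 𝕜 H) :
    ‖mapₗ T z‖ ≤ (∏ j, ‖T j‖) * ‖z‖ := by
  obtain ⟨n, c, x, rfl⟩ := exists_sum z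
  have h := (posSemidef_gram_sub_gram_map T x).dotProduct_mulVec_nonneg c
  have hz : mapₗ T (∑ a, c a • tprod 𝕜 (x a)) =
      ∑ a, c a • tprod 𝕜 fun j => T j (x a j) := by
    simp [map_sum, mapₗ_tprod]
  have key : star c ⬝ᵥ ((Matrix.of fun a b =>
      ∏ j, (((‖T j‖ ^ 2 : ℝ) : 𝕜) * inner 𝕜 (x a j) (x b j))
      - ∏ j, inner 𝕜 (T j (x a j)) (T j (x b j))).mulVec c) =
      ((((∏ j, ‖T j‖) * ‖∑ a, c a • tprod 𝕜 (x a)‖) ^ 2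
        - ‖∑ a, c a • tprod 𝕜 fun j => T j (x a j)‖ ^ 2 : ℝ) : 𝕜) := by
    rw [mul_pow, RCLike.ofReal_sub, RCLike.ofReal_mul, norm_sum_sq, norm_sum_sq]
    simp only [dotProduct, Matrix.mulVec, Matrix.of_apply, Finset.mul_sum, Finset.prod_mul_distrib,
      ← Finset.sum_sub_distrib, ← Finset.prod_pow, RCLike.ofReal_prod]
    refine Finset.sum_congr rfl fun a _ => Finset.sum_congr rfl fun b _ => ?_
    ring
  rw [key, RCLike.ofReal_nonneg, sub_nonneg] at h
  rw [hz]
  exact (sq_le_sq₀ (norm_nonneg _) (by positivity)).1 h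

/-- The algebraic tensor product of continuous linear maps. -/
noncomputable def map (T : ∀ j, H j →L[𝕜] K j) : AlgTensor 𝕜 H →L[𝕜] AlgTensor 𝕜 K :=
  (mapₗ T).mkContinuous (∏ j, ‖T j‖) (norm_mapₗ_le T)

theorem map_tprod (T : ∀ j, H j →L[𝕜] K j) (x : ∀ j, H j) :
    map T (tprod 𝕜 x) = tprod 𝕜 fun j => T j (x j) :=
  mapₗ_tprod T x

end AlgTensor

/-! ### Operators and orthonormal bases on the Hilbert tensor product -/

namespace HilbertTensor

variable {𝕜 : Type*} [RCLike 𝕜] {κ : Type*} [Fintype κ] {H K L : κ → Type*}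
  [∀ j, NormedAddCommGroup (H j)] [∀ j, InnerProductSpace 𝕜 (H j)]
  [∀ j, NormedAddCommGroup (K j)] [∀ j, InnerProductSpace 𝕜 (K j)]
  [∀ j, NormedAddCommGroup (L j)] [∀ j, InnerProductSpace 𝕜 (L j)]

theorem norm_tprod (x : ∀ j, H j) : ‖tprod 𝕜 x‖ = ∏ j, ‖x j‖ := by
  have h : ((‖tprod 𝕜 x‖ ^ 2 : ℝ) : 𝕜) = (((∏ j, ‖x j‖) ^ 2 : ℝ) : 𝕜) := by
    push_cast
    rw [← inner_self_eq_norm_sq_to_K (𝕜 := 𝕜), inner_tprod_tprod, ← Finset.prod_pow]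
    simp only [inner_self_eq_norm_sq_to_K]
  rw [RCLike.ofReal_inj] at h
  exact (pow_left_inj₀ (norm_nonneg _) (by positivity) two_ne_zero).1 h

theorem tprod_update_add [DecidableEq κ] (x : ∀ j, H j) (i : κ) (u v : H i) :
    tprod 𝕜 (Function.update x i (u + v)) =
      tprod 𝕜 (Function.update x i u) + tprod 𝕜 (Function.update x i v) := by
  rw [tprod, tprod, tprod, ← UniformSpace.Completion.coe_add]
  congr 1
  exact (PiTensorProduct.tprod 𝕜).map_update_add x i u v

theorem tprod_update_smul [DecidableEq κ] (x : ∀ j, H j) (i : κ) (c : 𝕜) (u : H i) :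
    tprod 𝕜 (Function.update x i (c • u)) = c • tprod 𝕜 (Function.update x i u) := by
  rw [tprod, tprod, ← UniformSpace.Completion.coe_smul]
  congr 1
  exact (PiTensorProduct.tprod 𝕜).map_update_smul x i c u

/-- The elementary tensor as a function of one of its entries. -/
noncomputable def tprodUpdate [DecidableEq κ] (x : ∀ j, H j) (i : κ) :
    H i →L[𝕜] HilbertTensor 𝕜 H :=
  LinearMap.mkContinuous
    { toFun := fun u => tprod 𝕜 (Function.update x i u)
      map_add' := tprod_update_add x i
      map_smul' := tprod_update_smul x i } (∏ j ∈ Finset.univ.erase i, ‖x j‖) fun u => by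
    change ‖tprod 𝕜 (Function.update x i u)‖ ≤ _
    rw [norm_tprod, ← Finset.prod_erase_mul _ _ (Finset.mem_univ i), Function.update_self]
    refine le_of_eq (congrArg (· * ‖u‖) (Finset.prod_congr rfl fun j hj => ?_))
    rw [Function.update_of_ne (Finset.ne_of_mem_erase hj)]

theorem tprodUpdate_apply [DecidableEq κ] (x : ∀ j, H j) (i : κ) (u : H i) :
    tprodUpdate (𝕜 := 𝕜) x i u = tprod 𝕜 (Function.update x i u) := rfl

theorem eq_top_of_tprod_mem {M : Submodule 𝕜 (HilbertTensor 𝕜 H)}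
    (hM : IsClosed (M : Set (HilbertTensor 𝕜 H))) (h : ∀ x : ∀ j, H j, tprod 𝕜 x ∈ M) :
    M = ⊤ := by
  refine Submodule.eq_top_iff'.2 fun z => ?_
  induction z using UniformSpace.Completion.induction_on with
  | hp => exact hM
  | ih u =>
    induction u using AlgTensor.induction with
    | htprod r x =>
      rw [UniformSpace.Completion.coe_smul]
      exact M.smul_mem r (h x)
    | hadd u v hu hv =>
      rw [UniformSpace.Completion.coe_add]
      exact M.add_mem hu hv

theorem ext_tprod {E : Type*} [NormedAddCommGroup E] [NormedSpace 𝕜 E]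
    {S T : HilbertTensor 𝕜 H →L[𝕜] E} (h : ∀ x : ∀ j, H j, S (tprod 𝕜 x) = T (tprod 𝕜 x)) :
    S = T := by
  have hker : (S - T).ker = ⊤ :=
    eq_top_of_tprod_mem (H := H) (M := (S - T).ker) (S - T).isClosed_ker fun x => by simp [h x]
  ext1 z
  have hz : z ∈ (S - T).ker := hker ▸ Submodule.mem_top
  exact sub_eq_zero.1 hz

/-- The Hilbert space tensor product of continuous linear maps. -/
noncomputable def map (T : ∀ j, H j →L[𝕜] K j) : HilbertTensor 𝕜 H →L[𝕜] HilbertTensor 𝕜 K :=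
  (UniformSpace.Completion.toComplL.comp (AlgTensor.map T)).extend
    (UniformSpace.Completion.toComplL (𝕜 := 𝕜) (E := AlgTensor 𝕜 H))

theorem map_tprod (T : ∀ j, H j →L[𝕜] K j) (x : ∀ j, H j) :
    map T (tprod 𝕜 x) = tprod 𝕜 fun j => T j (x j) := by
  have := (UniformSpace.Completion.toComplL.comp (AlgTensor.map T)).extend_eq
    (e := UniformSpace.Completion.toComplL (𝕜 := 𝕜) (E := AlgTensor 𝕜 H))
    UniformSpace.Completion.denseRange_coe
    (UniformSpace.Completion.isUniformInducing_coe _) (AlgTensor.tprod 𝕜 x)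
  refine this.trans ?_
  change ((AlgTensor.map T (AlgTensor.tprod 𝕜 x) : AlgTensor 𝕜 K) : HilbertTensor 𝕜 K) = _
  rw [AlgTensor.map_tprod, tprod]

theorem map_comp (S : ∀ j, K j →L[𝕜] L j) (T : ∀ j, H j →L[𝕜] K j) :
    map (fun j => (S j).comp (T j)) = (map S).comp (map T) :=
  ext_tprod fun x => by simp [map_tprod]

theorem map_id : map (fun j => ContinuousLinearMap.id 𝕜 (H j)) = ContinuousLinearMap.id 𝕜 _ :=
  ext_tprod fun x => by simp [map_tprod]

/-- The Hilbert space tensor product of continuous linear equivalences. -/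
noncomputable def mapEquiv (T : ∀ j, H j ≃L[𝕜] K j) :
    HilbertTensor 𝕜 H ≃L[𝕜] HilbertTensor 𝕜 K :=
  ContinuousLinearEquiv.equivOfInverse (map fun j => (T j : H j →L[𝕜] K j))
    (map fun j => ((T j).symm : K j →L[𝕜] H j))
    (fun z => by
      rw [← ContinuousLinearMap.comp_apply, ← map_comp]
      simp [map_id])
    (fun z => by
      rw [← ContinuousLinearMap.comp_apply, ← map_comp]
      simp [map_id])

theorem mapEquiv_tprod (T : ∀ j, H j ≃L[𝕜] K j) (x : ∀ j, H j) :
    mapEquiv T (tprod 𝕜 x) = tprod 𝕜 fun j => T j (x j) :=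
  map_tprod (fun j => (T j : H j →L[𝕜] K j)) x

variable {ι : κ → Type*}

theorem orthonormal_tensorFamily {e : ∀ j, ι j → H j} (he : ∀ j, Orthonormal 𝕜 (e j)) :
    Orthonormal 𝕜 (tensorFamily 𝕜 e) := by
  refine ⟨fun n => ?_, fun n m hnm => ?_⟩
  · rw [tensorFamily, norm_tprod]
    exact Finset.prod_eq_one fun j _ => (he j).1 _
  · obtain ⟨j, hj⟩ := Function.ne_iff.1 hnm
    simp only [tensorFamily, inner_tprod_tprod]
    exact Finset.prod_eq_zero (Finset.mem_univ j) ((he j).2 hj)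

/-- Slots are freed one at a time: with the others fixed, the entries in slot `i` that keep the
tensor in `M` form a closed subspace containing the range of `e i`. -/
theorem tprod_mem_of_dense_span {e : ∀ j, ι j → H j}
    (he : ∀ j, (Submodule.span 𝕜 (Set.range (e j))).topologicalClosure = ⊤)
    {M : Submodule 𝕜 (HilbertTensor 𝕜 H)} (hM : IsClosed (M : Set (HilbertTensor 𝕜 H)))
    (h : ∀ n, tensorFamily 𝕜 e n ∈ M) (x : ∀ j, H j) : tprod 𝕜 x ∈ M := by
  classical
  suffices ∀ (s : Finset κ) (x : ∀ j, H j), (∀ j ∉ s, x j ∈ Set.range (e j)) → tprod 𝕜 x ∈ M from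
    this Finset.univ x fun j hj => absurd (Finset.mem_univ j) hj
  intro s
  induction s using Finset.induction_on with
  | empty =>
    intro x hx
    choose n hn using fun j => hx j (Finset.notMem_empty j)
    obtain rfl : (fun j => e j (n j)) = x := funext hn
    exact h n
  | insert i s hi ih =>
    intro x hx
    have hle : (Submodule.span 𝕜 (Set.range (e i))).topologicalClosure ≤
        M.comap (tprodUpdate (𝕜 := 𝕜) x i : H i →ₗ[𝕜] HilbertTensor 𝕜 H) := by
      refine Submodule.topologicalClosure_minimal _ (Submodule.span_le.2 ?_)
        (hM.preimage (tprodUpdate (𝕜 := 𝕜) x i).continuous)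
      rintro _ ⟨m, rfl⟩
      refine ih _ fun j hj => ?_
      by_cases hji : j = i
      · subst hji
        rw [Function.update_self]
        exact ⟨m, rfl⟩
      · rw [Function.update_of_ne hji]
        exact hx j (by simp [hji, hj])
    rw [he i] at hle
    have := hle (Submodule.mem_top (x := x i))
    rwa [Submodule.mem_comap, ContinuousLinearMap.coe_coe, tprodUpdate_apply,
      Function.update_eq_self] at this

/-- The tensor product of Hilbert bases. -/
noncomputable def hilbertBasis (e : ∀ j, HilbertBasis (ι j) 𝕜 (H j)) :
    HilbertBasis (∀ j, ι j) 𝕜 (HilbertTensor 𝕜 H) :=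
  HilbertBasis.mk (orthonormal_tensorFamily fun j => (e j).orthonormal) <| top_le_iff.2 <|
    eq_top_of_tprod_mem (Submodule.isClosed_topologicalClosure _) <|
      tprod_mem_of_dense_span (fun j => (e j).dense_span) (Submodule.isClosed_topologicalClosure _)
        fun n => Submodule.le_topologicalClosure _ (Submodule.subset_span ⟨n, rfl⟩)

theorem hilbertBasis_apply (e : ∀ j, HilbertBasis (ι j) 𝕜 (H j)) (n : ∀ j, ι j) :
    hilbertBasis e n = tprod 𝕜 fun j => e j (n j) :=
  congrFun (HilbertBasis.coe_mk _ _) n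

end HilbertTensor

/-! ### Bessel families, frames and synthesis operators -/

open scoped lp in
/-- The standard Hilbert basis of `ℓ²`. -/
noncomputable def stdHilbertBasis (𝕜 : Type*) [RCLike 𝕜] (ι : Type*) :
    HilbertBasis ι 𝕜 ℓ²(ι, 𝕜) :=
  HilbertBasis.ofRepr (LinearIsometryEquiv.refl 𝕜 _)

section

variable {𝕜 : Type*} [RCLike 𝕜] {H K ι : Type*} [NormedAddCommGroup H] [InnerProductSpace 𝕜 H]
  [NormedAddCommGroup K] [InnerProductSpace 𝕜 K]

theorem HilbertBasis.hasSum_norm_inner_sq (e : HilbertBasis ι 𝕜 H) (x : H) :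
    HasSum (fun n => ‖inner 𝕜 (e n) x‖ ^ 2) (‖x‖ ^ 2) := by
  have h := e.hasSum_inner_mul_inner x x
  rw [inner_self_eq_norm_sq_to_K, ← RCLike.ofReal_pow] at h
  have h' := h.mapL (RCLike.reCLM (K := 𝕜))
  simp only [RCLike.reCLM_apply, RCLike.ofReal_re] at h'
  have hn : ∀ n, ‖inner 𝕜 (e n) x‖ ^ 2 = RCLike.re (inner 𝕜 x (e n) * inner 𝕜 (e n) x) := fun n => by
    rw [← inner_conj_symm x, RCLike.conj_mul, ← RCLike.ofReal_pow, RCLike.ofReal_re]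
  simpa only [hn] using h'

/-- The upper frame inequality. -/
def IsBessel (𝕜 : Type*) [RCLike 𝕜] {H ι : Type*} [NormedAddCommGroup H] [InnerProductSpace 𝕜 H]
    (f : ι → H) : Prop :=
  ∃ B : ℝ, ∀ x : H, Summable (fun n => ‖inner 𝕜 (f n) x‖ ^ 2) ∧
    ∑' n, ‖inner 𝕜 (f n) x‖ ^ 2 ≤ B * ‖x‖ ^ 2

theorem IsFrame.isBessel {f : ι → H} (hf : IsFrame 𝕜 f) : IsBessel 𝕜 f := by
  obtain ⟨A, B, -, -, h⟩ := hf
  exact ⟨B, fun x => ⟨(h x).1, (h x).2.2⟩⟩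

theorem IsBessel.zero : IsBessel 𝕜 (0 : ι → H) :=
  ⟨0, fun x => by simp [summable_zero]⟩

theorem IsBessel.smul {f : ι → H} (hf : IsBessel 𝕜 f) (c : 𝕜) : IsBessel 𝕜 (c • f) := by
  obtain ⟨B, h⟩ := hf
  refine ⟨‖c‖ ^ 2 * B, fun x => ?_⟩
  have hc : (fun n => ‖inner 𝕜 ((c • f) n) x‖ ^ 2) =
      fun n => ‖c‖ ^ 2 * ‖inner 𝕜 (f n) x‖ ^ 2 := by
    ext n
    simp [inner_smul_left, mul_pow]
  rw [hc, tsum_mul_left, mul_assoc]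
  exact ⟨(h x).1.mul_left _, by gcongr; exact (h x).2⟩

theorem IsBessel.add {f g : ι → H} (hf : IsBessel 𝕜 f) (hg : IsBessel 𝕜 g) :
    IsBessel 𝕜 (f + g) := by
  obtain ⟨B, hf⟩ := hf
  obtain ⟨C, hg⟩ := hg
  refine ⟨2 * B + 2 * C, fun x => ?_⟩
  have hle : ∀ n, ‖inner 𝕜 ((f + g) n) x‖ ^ 2 ≤
      2 * ‖inner 𝕜 (f n) x‖ ^ 2 + 2 * ‖inner 𝕜 (g n) x‖ ^ 2 := fun n => by
    rw [Pi.add_apply, inner_add_left]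
    have h₁ := norm_add_le (inner 𝕜 (f n) x) (inner 𝕜 (g n) x)
    nlinarith [norm_nonneg (inner 𝕜 (f n) x + inner 𝕜 (g n) x),
      sq_nonneg (‖inner 𝕜 (f n) x‖ - ‖inner 𝕜 (g n) x‖)]
  have hs := ((hf x).1.mul_left 2).add ((hg x).1.mul_left 2)
  have hs' := Summable.of_nonneg_of_le (fun n => by positivity) hle hs
  refine ⟨hs', (hs'.tsum_le_tsum hle hs).trans ?_⟩
  rw [((hf x).1.mul_left 2).tsum_add ((hg x).1.mul_left 2), tsum_mul_left, tsum_mul_left]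
  linarith [(hf x).2, (hg x).2]

/-- The image of a Hilbert basis under a bounded operator with a bounded right inverse is a
frame. -/
theorem HilbertBasis.isFrame_of_comp_eq_id [CompleteSpace H] [CompleteSpace K]
    (e : HilbertBasis ι 𝕜 K) {f : ι → H}
    (T : K →L[𝕜] H) (R : H →L[𝕜] K) (hTR : ∀ x, T (R x) = x) (hf : ∀ n, f n = T (e n)) :
    IsFrame 𝕜 f := by
  have hs : ∀ x, HasSum (fun n => ‖inner 𝕜 (f n) x‖ ^ 2) (‖T.adjoint x‖ ^ 2) := fun x => by
    simpa only [hf, ContinuousLinearMap.adjoint_inner_right] using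
      e.hasSum_norm_inner_sq (T.adjoint x)
  -- `R* T* = 1` bounds `T*` below. The `+ 1` keeps the constant positive when `R = 0`.
  have hR : ∀ x, ‖x‖ ≤ (‖R‖ + 1) * ‖T.adjoint x‖ := fun x => by
    have h₁ : R.adjoint (T.adjoint x) = x := by
      refine ext_inner_right 𝕜 fun y => ?_
      rw [ContinuousLinearMap.adjoint_inner_left, ContinuousLinearMap.adjoint_inner_left, hTR]
    calc ‖x‖ = ‖R.adjoint (T.adjoint x)‖ := by rw [h₁]
      _ ≤ ‖R.adjoint‖ * ‖T.adjoint x‖ := R.adjoint.le_opNorm _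
      _ ≤ (‖R‖ + 1) * ‖T.adjoint x‖ := by
        rw [LinearIsometryEquiv.norm_map]
        gcongr
        linarith
  refine ⟨((‖R‖ + 1) ^ 2)⁻¹, ‖T.adjoint‖ ^ 2 + 1, by positivity, by positivity, fun x => ?_⟩
  rw [(hs x).tsum_eq]
  refine ⟨(hs x).summable, ?_, ?_⟩
  · rw [inv_mul_le_iff₀ (by positivity), ← mul_pow]
    gcongr
    exact hR x
  · have h : ‖T.adjoint x‖ ^ 2 ≤ (‖T.adjoint‖ * ‖x‖) ^ 2 := by
      gcongr
      exact T.adjoint.le_opNorm _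
    rw [mul_pow] at h
    nlinarith [sq_nonneg ‖x‖]

open scoped lp in
/-- The synthesis operator of a Bessel family. -/
theorem IsBessel.exists_synthesis [CompleteSpace H] {f : ι → H} (hf : IsBessel 𝕜 f) :
    ∃ T : ℓ²(ι, 𝕜) →L[𝕜] H, ∀ n, f n = T (stdHilbertBasis 𝕜 ι n) := by
  obtain ⟨B, h⟩ := hf
  have hmem : ∀ x, Memℓp (fun n => inner 𝕜 (f n) x : ι → 𝕜) 2 := fun x => by
    refine memℓp_gen ?_
    simpa using (h x).1
  -- The analysis operator, bounded by the Bessel inequality; its adjoint is the synthesis operator.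
  let U : H →ₗ[𝕜] ℓ²(ι, 𝕜) :=
    { toFun := fun x => ⟨fun n => inner 𝕜 (f n) x, hmem x⟩
      map_add' := fun x y => by
        ext n
        exact inner_add_right _ _ _
      map_smul' := fun c x => by
        ext n
        exact inner_smul_right _ _ _ }
  have hU : ∀ x, ‖U x‖ ≤ √B * ‖x‖ := fun x => by
    have h₁ : ‖U x‖ ^ 2 = ∑' n, ‖inner 𝕜 (f n) x‖ ^ 2 := by
      have := lp.norm_rpow_eq_tsum (p := 2) (by simp) (U x)
      simp only [ENNReal.toReal_ofNat, Real.rpow_two] at this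
      exact this
    rw [← Real.sqrt_sq (norm_nonneg x), ← Real.sqrt_mul' _ (sq_nonneg _)]
    exact Real.le_sqrt_of_sq_le (h₁ ▸ (h x).2)
  refine ⟨(U.mkContinuous _ hU).adjoint, fun n => ext_inner_right 𝕜 fun x => ?_⟩
  rw [ContinuousLinearMap.adjoint_inner_left, ← HilbertBasis.repr_apply_apply]
  rfl

/-- The synthesis operator of a frame has a bounded right inverse. -/
theorem IsFrame.exists_right_inverse [CompleteSpace H] [CompleteSpace K] {f : ι → H}
    (hf : IsFrame 𝕜 f) (e : HilbertBasis ι 𝕜 K) (T : K →L[𝕜] H) (hT : ∀ n, f n = T (e n)) :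
    ∃ R : H →L[𝕜] K, ∀ x, T (R x) = x := by
  obtain ⟨A, B, hA, -, h⟩ := hf
  -- Being bounded below, `T*` is injective with closed range, so it has a bounded left inverse; the
  -- adjoint of that inverse is the right inverse of `T`.
  have hbound : ∀ x, √A * ‖x‖ ≤ ‖T.adjoint x‖ := fun x => by
    have hs := e.hasSum_norm_inner_sq (T.adjoint x)
    simp only [ContinuousLinearMap.adjoint_inner_right, ← hT] at hs
    rw [← Real.sqrt_sq (norm_nonneg x), ← Real.sqrt_mul' _ (sq_nonneg _)]
    exact Real.sqrt_le_iff.2 ⟨norm_nonneg _, hs.tsum_eq ▸ (h x).2.1⟩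
  have hanti : AntilipschitzWith (Real.toNNReal (√A)⁻¹) T.adjoint :=
    AddMonoidHomClass.antilipschitz_of_bound _ fun x => by
      rw [Real.coe_toNNReal _ (by positivity), inv_mul_eq_div,
        le_div_iff₀ (Real.sqrt_pos.2 hA), mul_comm]
      exact hbound x
  have hclosed := hanti.isClosed_range T.adjoint.uniformContinuous
  have : CompleteSpace (T.adjoint).range := hclosed.completeSpace_coe
  have hleft : (T.adjoint).HasLeftInverse :=
    .of_injective_of_isClosed_range_of_closedComplement_range hanti.injective hclosed
      ⟨(T.adjoint).range.orthogonalProjectionOnto,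
        Submodule.orthogonalProjectionOnto_mem_subspace_eq_self⟩
  obtain ⟨L, hL⟩ := hleft
  refine ⟨L.adjoint, fun x => ext_inner_right 𝕜 fun y => ?_⟩
  rw [← ContinuousLinearMap.adjoint_inner_right, ContinuousLinearMap.adjoint_inner_left, hL]

theorem isFrame_iff [CompleteSpace H] {f : ι → H} (hf : IsBessel 𝕜 f) :
    IsFrame 𝕜 f ↔ ∃ A > 0, ∀ x, A * ‖x‖ ^ 2 ≤ ∑' n, ‖inner 𝕜 (f n) x‖ ^ 2 := by
  constructor
  · rintro ⟨A, B, hA, hB, h⟩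
    exact ⟨A, hA, fun x => (h x).2.1⟩
  · rintro ⟨A, hA, h⟩
    obtain ⟨B, hB⟩ := hf
    -- A Bessel constant need not be positive, whereas a frame constant must be.
    refine ⟨A, |B| + 1, hA, by positivity, fun x => ⟨(hB x).1, h x, (hB x).2.trans ?_⟩⟩
    gcongr
    linarith [le_abs_self B]

theorem HilbertBasis.finite_iff_finiteDimensional (e : HilbertBasis ι 𝕜 H) :
    Finite ι ↔ FiniteDimensional 𝕜 H := by
  constructor
  · intro _
    cases nonempty_fintype ι
    exact Module.Finite.of_basis e.toOrthonormalBasis.toBasis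
  · intro _
    exact (e.orthonormal.linearIndependent).finite

/-- Distinct basis vectors are at distance `√2`, so the balls of radius `1 / 2` around them are
disjoint. -/
theorem HilbertBasis.countable [TopologicalSpace.SeparableSpace H] (e : HilbertBasis ι 𝕜 H) :
    Countable ι := by
  refine Pairwise.countable_of_isOpen_disjoint (s := fun n => Metric.ball (e n) (1 / 2))
    (fun n m hnm => Metric.ball_disjoint_ball ?_) (fun _ => Metric.isOpen_ball)
    fun n => Metric.nonempty_ball.2 (by norm_num)
  have h : ‖e n - e m‖ ^ 2 = 2 := by
    rw [@norm_sub_sq 𝕜, e.orthonormal.1, e.orthonormal.1, e.orthonormal.2 hnm]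
    norm_num
  rw [dist_eq_norm]
  nlinarith [norm_nonneg (e n - e m)]

/-- Used to index a basis of `H` by the index set of the frame, as `IsRieszBasis` demands. Finite
index sets are compared by dimension; infinite countable ones are always equipotent. -/
theorem HilbertBasis.nonempty_equiv {ι' : Type*} [Countable ι] [Countable ι']
    (e : HilbertBasis ι 𝕜 H) (e' : HilbertBasis ι' 𝕜 K) (T : H ≃ₗ[𝕜] K) : Nonempty (ι ≃ ι') := by
  have hiff : Finite ι ↔ Finite ι' := by
    rw [e.finite_iff_finiteDimensional, e'.finite_iff_finiteDimensional]
    exact ⟨fun _ => T.finiteDimensional, fun _ => T.symm.finiteDimensional⟩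
  rcases finite_or_infinite ι with h | h
  · have := hiff.1 h
    cases nonempty_fintype ι
    cases nonempty_fintype ι'
    refine ⟨Fintype.equivOfCardEq ?_⟩
    rw [← Module.finrank_eq_card_basis e.toOrthonormalBasis.toBasis,
      ← Module.finrank_eq_card_basis e'.toOrthonormalBasis.toBasis, T.finrank_eq]
  · have : Infinite ι' := not_finite_iff_infinite.1 fun h' => h.not_finite (hiff.2 h')
    exact nonempty_equiv_of_countable

open scoped lp in
/-- A frame of a separable space with injective synthesis operator is a Riesz basis. -/
theorem IsFrame.isRieszBasis [CompleteSpace H] [TopologicalSpace.SeparableSpace H] [Countable ι]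
    {f : ι → H} (hf : IsFrame 𝕜 f) (T : ℓ²(ι, 𝕜) →L[𝕜] H)
    (hT : ∀ n, f n = T (stdHilbertBasis 𝕜 ι n)) (hinj : Function.Injective T) :
    IsRieszBasis 𝕜 f := by
  obtain ⟨R, hR⟩ := hf.exists_right_inverse _ T hT
  let S : ℓ²(ι, 𝕜) ≃L[𝕜] H := ContinuousLinearEquiv.equivOfInverse T R
    (fun v => hinj (hR (T v))) hR
  obtain ⟨w, b, -⟩ := exists_hilbertBasis 𝕜 H
  have := b.countable
  obtain ⟨σ⟩ := (stdHilbertBasis 𝕜 ι).nonempty_equiv b S.toLinearEquiv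
  let e : HilbertBasis ι 𝕜 H := HilbertBasis.mk (b.orthonormal.comp σ σ.injective) (by
    rw [σ.surjective.range_comp, b.dense_span])
  -- The operator on `H` passes through `ℓ²`: `e.repr` takes `e n` to the standard basis vector,
  -- which `S` takes to `f n`.
  refine ⟨hf, e, e.repr.toContinuousLinearEquiv.trans S, fun n => ?_⟩
  classical
  rw [hT, ContinuousLinearEquiv.trans_apply]
  change _ = T (e.repr (e n))
  rw [e.repr_self, ← (stdHilbertBasis 𝕜 ι).repr_self]
  rfl

end

/-! ### Tensor products of frames and of Riesz bases -/

section

variable {𝕜 : Type*} [RCLike 𝕜] {κ : Type*} [Fintype κ] {H : κ → Type*}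
  [∀ j, NormedAddCommGroup (H j)] [∀ j, InnerProductSpace 𝕜 (H j)] [∀ j, CompleteSpace (H j)]
  {ι : κ → Type*}

/-- Bounded right inverses survive tensoring: `(⨂ T j)(⨂ R j) = ⨂ (T j R j) = 1`. -/
theorem isFrame_tensorFamily {f : ∀ j, ι j → H j} (hf : ∀ j, IsFrame 𝕜 (f j)) :
    IsFrame 𝕜 (tensorFamily 𝕜 f) := by
  choose T hT using fun j => (hf j).isBessel.exists_synthesis
  choose R hR using fun j => (hf j).exists_right_inverse _ (T j) (hT j)
  refine (HilbertTensor.hilbertBasis fun j => stdHilbertBasis 𝕜 (ι j)).isFrame_of_comp_eq_id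
    (HilbertTensor.map T) (HilbertTensor.map R) (fun z => ?_) fun n => ?_
  · rw [← ContinuousLinearMap.comp_apply, ← HilbertTensor.map_comp]
    have : (fun j => (T j).comp (R j)) = fun j => ContinuousLinearMap.id 𝕜 (H j) :=
      funext fun j => ContinuousLinearMap.ext (hR j)
    rw [this, HilbertTensor.map_id, ContinuousLinearMap.id_apply]
  · simp only [HilbertTensor.hilbertBasis_apply, HilbertTensor.map_tprod, ← hT]
    rfl

theorem isRieszBasis_tensorFamily {f : ∀ j, ι j → H j} (hf : ∀ j, IsRieszBasis 𝕜 (f j)) :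
    IsRieszBasis 𝕜 (tensorFamily 𝕜 f) := by
  choose hframe e T hT using hf
  refine ⟨isFrame_tensorFamily hframe, HilbertTensor.hilbertBasis e, HilbertTensor.mapEquiv T,
    fun n => ?_⟩
  simp only [HilbertTensor.hilbertBasis_apply, HilbertTensor.mapEquiv_tprod, ← hT]
  rfl

end

/-- If `P i` and `Q l` fail, then `i = l`; pairing any other index with this one in both orders
gives `P` and `Q` there. -/
theorem exists_forall_ne_of_forall_ne_or {κ : Type*} {P Q : κ → Prop}
    (h : ∀ i l, i ≠ l → P i ∨ Q l) :
    (∀ j, P j) ∨ (∀ j, Q j) ∨ ∃ i, ∀ j, j ≠ i → P j ∧ Q j := by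
  by_cases hP : ∀ j, P j
  · exact .inl hP
  by_cases hQ : ∀ j, Q j
  · exact .inr (.inl hQ)
  push Not at hP hQ
  obtain ⟨i, hi⟩ := hP
  obtain ⟨l, hl⟩ := hQ
  obtain rfl : i = l := by
    by_contra hil
    exact (h i l hil).elim hi hl
  exact .inr (.inr ⟨i, fun j hj => ⟨(h j i hj).resolve_right hl, (h i j hj.symm).resolve_left hi⟩⟩)

/-! ### Sums of two tensor families -/

section

variable {𝕜 : Type*} [RCLike 𝕜] {H K ι : Type*} [NormedAddCommGroup H] [InnerProductSpace 𝕜 H]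
  [NormedAddCommGroup K] [InnerProductSpace 𝕜 K]

/-- For a Bessel family only the lower bound can fail, and `‖T* x‖²` is the frame sum at `x`;
homogeneity reduces to unit vectors. -/
theorem IsBessel.exists_norm_adjoint_lt [CompleteSpace H] [CompleteSpace K] {f : ι → H}
    (hf : IsBessel 𝕜 f) (hnf : ¬ IsFrame 𝕜 f) (e : HilbertBasis ι 𝕜 K) (T : K →L[𝕜] H)
    (hT : ∀ n, f n = T (e n)) {ε : ℝ} (hε : 0 < ε) : ∃ x, ‖x‖ = 1 ∧ ‖T.adjoint x‖ < ε := by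
  by_contra! hcon
  refine hnf ((isFrame_iff hf).2 ⟨ε ^ 2, by positivity, fun x => ?_⟩)
  have hs := e.hasSum_norm_inner_sq (T.adjoint x)
  simp only [ContinuousLinearMap.adjoint_inner_right, ← hT] at hs
  rw [hs.tsum_eq, ← mul_pow]
  rcases eq_or_ne x 0 with rfl | hx
  · simp
  have hx' : 0 < ‖x‖ := norm_pos_iff.2 hx
  have h := hcon (((‖x‖⁻¹ : ℝ) : 𝕜) • x) (by
    rw [norm_smul, RCLike.norm_ofReal, abs_of_pos (by positivity), inv_mul_cancel₀ hx'.ne'])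
  rw [map_smul, norm_smul, RCLike.norm_ofReal, abs_of_pos (by positivity), inv_mul_eq_div,
    le_div_iff₀ hx'] at h
  gcongr

end

section

variable {𝕜 : Type*} [RCLike 𝕜] {κ : Type*} [Fintype κ] [DecidableEq κ] {H : κ → Type*}
  [∀ j, NormedAddCommGroup (H j)] [∀ j, InnerProductSpace 𝕜 (H j)]
  {ι : κ → Type*} {f g : ∀ j, ι j → H j}

/-- The frozen slots contribute a scalar. Moving it into the conjugate-linear argument reverses its
inner products. -/
theorem inner_tensorFamily_update (f : ∀ j, ι j → H j) (i : κ) (n : ∀ j, ι j) (x : ∀ j, H j)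
    (m : ι i) (y : H i) :
    inner 𝕜 (tensorFamily 𝕜 f (Function.update n i m))
        (HilbertTensor.tprod 𝕜 (Function.update x i y)) =
      inner 𝕜 ((∏ j ∈ Finset.univ.erase i, inner 𝕜 (x j) (f j (n j))) • f i m) y := by
  rw [tensorFamily, HilbertTensor.inner_tprod_tprod, inner_smul_left, map_prod,
    ← Finset.prod_erase_mul _ _ (Finset.mem_univ i), Function.update_self, Function.update_self]
  congr 1
  refine Finset.prod_congr rfl fun j hj => ?_
  rw [Function.update_of_ne (Finset.ne_of_mem_erase hj),
    Function.update_of_ne (Finset.ne_of_mem_erase hj), inner_conj_symm]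

/-- The slices of a Bessel sum of two tensor families are Bessel. -/
theorem IsBessel.slice (h : IsBessel 𝕜 (tensorFamily 𝕜 f + tensorFamily 𝕜 g)) (i : κ)
    (n : ∀ j, ι j) (x : ∀ j, H j) :
    IsBessel 𝕜 ((∏ j ∈ Finset.univ.erase i, inner 𝕜 (x j) (f j (n j))) • f i +
      (∏ j ∈ Finset.univ.erase i, inner 𝕜 (x j) (g j (n j))) • g i) := by
  obtain ⟨B, h⟩ := h
  refine ⟨B * (∏ j ∈ Finset.univ.erase i, ‖x j‖) ^ 2, fun y => ?_⟩
  -- Test on elementary tensors varying only in slot `i`, and keep only the multi-indices that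
  -- differ from `n` at most there.
  obtain ⟨hs, hB⟩ := h (HilbertTensor.tprod 𝕜 (Function.update x i y))
  have hinj : Function.Injective (Function.update n i) := Function.update_injective n i
  have heq : ∀ m, ‖inner 𝕜 (((∏ j ∈ Finset.univ.erase i, inner 𝕜 (x j) (f j (n j))) • f i +
      (∏ j ∈ Finset.univ.erase i, inner 𝕜 (x j) (g j (n j))) • g i) m) y‖ ^ 2 =
      ‖inner 𝕜 ((tensorFamily 𝕜 f + tensorFamily 𝕜 g) (Function.update n i m))
        (HilbertTensor.tprod 𝕜 (Function.update x i y))‖ ^ 2 := fun m => by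
    rw [Pi.add_apply, Pi.add_apply, inner_add_left, inner_add_left, inner_tensorFamily_update,
      inner_tensorFamily_update]
    rfl
  have hnorm : ‖HilbertTensor.tprod 𝕜 (Function.update x i y)‖ =
      (∏ j ∈ Finset.univ.erase i, ‖x j‖) * ‖y‖ := by
    rw [HilbertTensor.norm_tprod, ← Finset.prod_erase_mul _ _ (Finset.mem_univ i),
      Function.update_self]
    congr 1
    refine Finset.prod_congr rfl fun j hj => ?_
    rw [Function.update_of_ne (Finset.ne_of_mem_erase hj)]
  simp only [heq]
  refine ⟨hs.comp_injective hinj, ?_⟩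
  rw [mul_assoc, ← mul_pow, ← hnorm]
  exact (tsum_comp_le_tsum_of_inj hs (fun _ => by positivity) hinj).trans hB

theorem LinearIndependent.exists_ne_zero {E ι : Type*} [AddCommGroup E] [Module 𝕜 E] {f g : ι → E}
    (h : LinearIndependent 𝕜 ![f, g]) : ∃ n, f n ≠ 0 :=
  Function.ne_iff.1 (h.ne_zero 0)

/-- Vary only slot `l` and put `x j = f j (n j) ≠ 0` in the slots other than `i` and `l`. This gives
a linear relation between `f l` and `g l` in which `f l` has coefficient `c` times a nonzero
product. The factor of `c'` may vanish, so `c' = 0` needs the roles exchanged. -/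
theorem eq_zero_of_forall_prod_inner (hfg : ∀ j, LinearIndependent 𝕜 ![f j, g j]) {i l : κ}
    (hil : i ≠ l) {c c' : 𝕜}
    (h : ∀ (n : ∀ j, ι j) (x : ∀ j, H j),
      (∏ j ∈ Finset.univ.erase i, inner 𝕜 (x j) (f j (n j))) * c +
        (∏ j ∈ Finset.univ.erase i, inner 𝕜 (x j) (g j (n j))) * c' = 0) : c = 0 := by
  choose n hn using fun j => (hfg j).exists_ne_zero
  set s := (Finset.univ.erase i).erase l with hs
  have hl : l ∈ Finset.univ.erase i := by simp [hil.symm]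
  have hsplit : ∀ (u : ∀ j, ι j → H j) (k : ι l) (y : H l),
      ∏ j ∈ Finset.univ.erase i, inner 𝕜 (Function.update (fun j => f j (n j)) l y j)
        (u j (Function.update n l k j)) =
      inner 𝕜 y (u l k) * ∏ j ∈ s, inner 𝕜 (f j (n j)) (u j (n j)) := fun u k y => by
    rw [← Finset.mul_prod_erase _ _ hl, Function.update_self, Function.update_self]
    congr 1
    refine Finset.prod_congr rfl fun j hj => ?_
    rw [Function.update_of_ne (Finset.ne_of_mem_erase hj),
      Function.update_of_ne (Finset.ne_of_mem_erase hj)]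
  have hzero := LinearIndependent.pair_iff.1 (hfg l)
    (c * ∏ j ∈ s, inner 𝕜 (f j (n j)) (f j (n j)))
    (c' * ∏ j ∈ s, inner 𝕜 (f j (n j)) (g j (n j))) (by
      ext k
      refine ext_inner_left 𝕜 fun y => ?_
      have := h (Function.update n l k) (Function.update (fun j => f j (n j)) l y)
      rw [hsplit, hsplit] at this
      simp only [Pi.add_apply, Pi.smul_apply, inner_add_right, inner_smul_right, Pi.zero_apply,
        inner_zero_right]
      rw [← this]
      ring)
  refine (mul_eq_zero.1 hzero.1).resolve_right (Finset.prod_ne_zero_iff.2 fun j _ => ?_)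
  exact inner_self_ne_zero.2 (hn j)

/-- The factors of a Bessel sum of two tensor families are Bessel. -/
theorem IsBessel.of_tensorFamily_add (hfg : ∀ j, LinearIndependent 𝕜 ![f j, g j])
    (h : IsBessel 𝕜 (tensorFamily 𝕜 f + tensorFamily 𝕜 g)) {i l : κ} (hil : i ≠ l) :
    IsBessel 𝕜 (f i) ∧ IsBessel 𝕜 (g i) := by
  let V : Submodule 𝕜 (𝕜 × 𝕜) :=
    { carrier := {p | IsBessel 𝕜 (p.1 • f i + p.2 • g i)}
      zero_mem' := by simpa using IsBessel.zero
      add_mem' := fun {p q} hp hq => by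
        have := IsBessel.add hp hq
        rw [add_add_add_comm, ← add_smul, ← add_smul] at this
        exact this
      smul_mem' := fun c p hp => by
        have := IsBessel.smul hp c
        rw [smul_add, smul_smul, smul_smul] at this
        exact this }
  -- Otherwise a nonzero functional `φ` kills `V`, hence all slice coefficients;
  -- `eq_zero_of_forall_prod_inner`, applied in both orders, makes `φ` zero.
  have hV : V = ⊤ := by
    by_contra hne
    obtain ⟨φ, hφ, hle⟩ := V.exists_le_ker_of_lt_top (lt_top_iff_ne_top.2 hne)
    have hφ' : ∀ a b, φ (a, b) = a * φ (1, 0) + b * φ (0, 1) := fun a b => by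
      rw [← smul_eq_mul, ← smul_eq_mul, ← map_smul, ← map_smul, ← map_add]
      simp
    have hvan : ∀ (n : ∀ j, ι j) (x : ∀ j, H j),
        (∏ j ∈ Finset.univ.erase i, inner 𝕜 (x j) (f j (n j))) * φ (1, 0) +
          (∏ j ∈ Finset.univ.erase i, inner 𝕜 (x j) (g j (n j))) * φ (0, 1) = 0 := fun n x => by
      rw [← hφ']
      exact hle (h.slice i n x)
    have h₁ := eq_zero_of_forall_prod_inner hfg hil hvan
    have hgf : ∀ j, LinearIndependent 𝕜 ![g j, f j] := fun j =>
      LinearIndependent.pair_symm_iff.1 (hfg j)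
    have h₂ := eq_zero_of_forall_prod_inner hgf hil
      fun n x => (add_comm _ _).trans (hvan n x)
    refine hφ (LinearMap.ext fun p => ?_)
    obtain ⟨a, b⟩ := p
    rw [hφ', h₁, h₂, mul_zero, mul_zero, add_zero, LinearMap.zero_apply]
  have hmem := Submodule.eq_top_iff'.1 hV
  have h₁ : IsBessel 𝕜 ((1 : 𝕜) • f i + (0 : 𝕜) • g i) := hmem (1, 0)
  have h₂ : IsBessel 𝕜 ((0 : 𝕜) • f i + (1 : 𝕜) • g i) := hmem (0, 1)
  rw [one_smul, zero_smul, add_zero] at h₁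
  rw [one_smul, zero_smul, zero_add] at h₂
  exact ⟨h₁, h₂⟩

theorem prod_norm_apply_le {E F : κ → Type*} [∀ j, NormedAddCommGroup (E j)]
    [∀ j, NormedSpace 𝕜 (E j)] [∀ j, NormedAddCommGroup (F j)] [∀ j, NormedSpace 𝕜 (F j)]
    (T : ∀ j, E j →L[𝕜] F j) {x : ∀ j, E j} (hx : ∀ j, ‖x j‖ = 1) (i : κ) {ε : ℝ}
    (hi : ‖T i (x i)‖ ≤ ε) :
    ∏ j, ‖T j (x j)‖ ≤ (∏ j ∈ Finset.univ.erase i, ‖T j‖) * ε := by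
  rw [← Finset.prod_erase_mul _ _ (Finset.mem_univ i)]
  gcongr with j _
  exact (T j).unit_le_opNorm _ (hx j).le

/-- If both failed, a tensor of unit vectors, almost annihilated by `(T i)*` in slot `i` and by `(S
l)*` in slot `l`, would violate the lower bound. -/
theorem IsFrame.left_or_right_of_tensorFamily_add [∀ j, CompleteSpace (H j)]
    (hfg : ∀ j, LinearIndependent 𝕜 ![f j, g j])
    (h : IsFrame 𝕜 (tensorFamily 𝕜 f + tensorFamily 𝕜 g)) {i l : κ} (hil : i ≠ l) :
    IsFrame 𝕜 (f i) ∨ IsFrame 𝕜 (g l) := by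
  -- Each slot needs a different companion slot: `l` for `i`, and `i` for all others.
  have hB : ∀ j, IsBessel 𝕜 (f j) ∧ IsBessel 𝕜 (g j) := fun j => by
    rcases eq_or_ne j i with rfl | hj
    · exact h.isBessel.of_tensorFamily_add hfg hil
    · exact h.isBessel.of_tensorFamily_add hfg hj
  choose T hT using fun j => (hB j).1.exists_synthesis
  choose S hS using fun j => (hB j).2.exists_synthesis
  obtain ⟨A, B, hA, -, hAB⟩ := h
  by_contra! hcon
  obtain ⟨C, hC⟩ : ∃ C, C = ∏ j ∈ Finset.univ.erase i, ‖(T j).adjoint‖ := ⟨_, rfl⟩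
  obtain ⟨D, hD⟩ : ∃ D, D = ∏ j ∈ Finset.univ.erase l, ‖(S j).adjoint‖ := ⟨_, rfl⟩
  have hC0 : 0 ≤ C := hC ▸ Finset.prod_nonneg fun _ _ => norm_nonneg _
  have hD0 : 0 ≤ D := hD ▸ Finset.prod_nonneg fun _ _ => norm_nonneg _
  -- `C` and `D` bound the remaining factors; this threshold makes the total `(C + D) * ε` less than
  -- `√A`.
  have hε : 0 < √A / (C + D + 1) := by positivity
  obtain ⟨u, hu, hu'⟩ := (hB i).1.exists_norm_adjoint_lt hcon.1 _ (T i) (hT i) hε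
  obtain ⟨v, hv, hv'⟩ := (hB l).2.exists_norm_adjoint_lt hcon.2 _ (S l) (hS l) hε
  have hunit : ∀ j, ∃ y : H j, ‖y‖ = 1 := fun j => by
    obtain ⟨n, hn⟩ := (hfg j).exists_ne_zero
    exact ⟨((‖f j n‖⁻¹ : ℝ) : 𝕜) • f j n, by
      rw [norm_smul, RCLike.norm_ofReal, abs_of_nonneg (by positivity),
        inv_mul_cancel₀ (norm_ne_zero_iff.2 hn)]⟩
  choose y hy using hunit
  obtain ⟨x, hx, hxi, hxl⟩ : ∃ x : ∀ j, H j, (∀ j, ‖x j‖ = 1) ∧ x i = u ∧ x l = v := by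
    refine ⟨Function.update (Function.update y i u) l v, fun j => ?_, ?_, ?_⟩
    · rcases eq_or_ne j l with rfl | hjl
      · simpa using hv
      · rw [Function.update_of_ne hjl]
        rcases eq_or_ne j i with rfl | hji
        · simpa using hu
        · rw [Function.update_of_ne hji, hy]
    · rw [Function.update_of_ne hil, Function.update_self]
    · rw [Function.update_self]
  have hxi' : ‖(T i).adjoint (x i)‖ ≤ √A / (C + D + 1) := by rw [hxi]; exact hu'.le
  have hxl' : ‖(S l).adjoint (x l)‖ ≤ √A / (C + D + 1) := by rw [hxl]; exact hv'.le
  have hs := (HilbertTensor.hilbertBasis fun j => stdHilbertBasis 𝕜 (ι j)).hasSum_norm_inner_sq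
    (HilbertTensor.tprod 𝕜 (fun j => (T j).adjoint (x j)) +
      HilbertTensor.tprod 𝕜 (fun j => (S j).adjoint (x j)))
  -- By Parseval the frame sum at `⨂ x j` is therefore the squared norm of `⨂ (T j)* x j + ⨂ (S j)*
  -- x j`.
  have heq : ∀ n, inner 𝕜 ((HilbertTensor.hilbertBasis fun j => stdHilbertBasis 𝕜 (ι j)) n)
      (HilbertTensor.tprod 𝕜 (fun j => (T j).adjoint (x j)) +
        HilbertTensor.tprod 𝕜 (fun j => (S j).adjoint (x j))) =
      inner 𝕜 ((tensorFamily 𝕜 f + tensorFamily 𝕜 g) n) (HilbertTensor.tprod 𝕜 x) := fun n => by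
    simp only [HilbertTensor.hilbertBasis_apply, inner_add_right, Pi.add_apply, inner_add_left,
      tensorFamily, HilbertTensor.inner_tprod_tprod, ContinuousLinearMap.adjoint_inner_right,
      ← hT, ← hS]
  simp only [heq] at hs
  have hlow := (hAB (HilbertTensor.tprod 𝕜 x)).2.1
  rw [hs.tsum_eq, HilbertTensor.norm_tprod, Finset.prod_eq_one fun j _ => hx j, one_pow,
    mul_one] at hlow
  have hup : ‖HilbertTensor.tprod 𝕜 (fun j => (T j).adjoint (x j)) +
      HilbertTensor.tprod 𝕜 (fun j => (S j).adjoint (x j))‖ ≤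
      (C + D) * (√A / (C + D + 1)) := by
    refine (norm_add_le _ _).trans ?_
    rw [HilbertTensor.norm_tprod, HilbertTensor.norm_tprod, add_mul]
    nth_rw 1 [hC]
    nth_rw 2 [hD]
    exact add_le_add
      (prod_norm_apply_le (fun j => (T j).adjoint) hx i hxi')
      (prod_norm_apply_le (fun j => (S j).adjoint) hx l hxl')
  have hlt : (C + D) * (√A / (C + D + 1)) < √A := by
    rw [mul_div_assoc', div_lt_iff₀ (by positivity)]
    nlinarith [Real.sqrt_pos.2 hA]
  exact absurd (Real.sqrt_le_iff.2 ⟨norm_nonneg _, hlow⟩) (not_le.2 (hup.trans_lt hlt))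

/-- A frame that is not a Riesz basis has a synthesis operator with nonzero kernel. Kernel vectors
of `T i` and `S l`, placed in one elementary tensor, would give a nonzero kernel vector of the
invertible operator `⨂ T j + ⨂ S j`. -/
theorem IsRieszBasis.left_or_right_of_tensorFamily_add [∀ j, CompleteSpace (H j)]
    [∀ j, TopologicalSpace.SeparableSpace (H j)] [∀ j, Countable (ι j)]
    (hf : ∀ j, IsFrame 𝕜 (f j)) (hg : ∀ j, IsFrame 𝕜 (g j)) (hι : ∀ j, Nonempty (ι j))
    (h : IsRieszBasis 𝕜 (tensorFamily 𝕜 f + tensorFamily 𝕜 g)) {i l : κ} (hil : i ≠ l) :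
    IsRieszBasis 𝕜 (f i) ∨ IsRieszBasis 𝕜 (g l) := by
  choose T hT using fun j => (hf j).isBessel.exists_synthesis
  choose S hS using fun j => (hg j).isBessel.exists_synthesis
  obtain ⟨-, E, Φ, hΦ⟩ := h
  by_contra! hcon
  have hTi : ¬ Function.Injective (T i) := fun hi =>
    hcon.1 ((hf i).isRieszBasis (T i) (hT i) hi)
  have hSl : ¬ Function.Injective (S l) := fun hl =>
    hcon.2 ((hg l).isRieszBasis (S l) (hS l) hl)
  rw [injective_iff_map_eq_zero] at hTi hSl
  push Not at hTi hSl
  obtain ⟨u, hu, hu0⟩ := hTi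
  obtain ⟨v, hv, hv0⟩ := hSl
  set e := HilbertTensor.hilbertBasis fun j => stdHilbertBasis 𝕜 (ι j) with he
  -- Both sides send the basis vector `e n` to the `n`-th member of the sum family, and the `e n`
  -- have dense span.
  have hW : HilbertTensor.map T + HilbertTensor.map S =
      ((e.repr.trans E.repr.symm).toContinuousLinearEquiv.trans Φ :
        HilbertTensor 𝕜 _ →L[𝕜] HilbertTensor 𝕜 H) := by
    classical
    refine ContinuousLinearMap.ext_on
      (Submodule.dense_iff_topologicalClosure_eq_top.2 e.dense_span) ?_
    rintro _ ⟨n, rfl⟩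
    have h₁ : Φ (E.repr.symm (e.repr (e n))) = Φ (E n) := by
      rw [e.repr_self, E.repr_symm_single]
    refine Eq.trans ?_ h₁.symm
    rw [← hΦ, he, HilbertTensor.hilbertBasis_apply, add_apply,
      HilbertTensor.map_tprod, HilbertTensor.map_tprod]
    simp only [← hT, ← hS]
    rfl
  obtain ⟨x, hx, hxi, hxl⟩ : ∃ x : ∀ j, lp (fun _ : ι j => 𝕜) 2,
      (∀ j, x j ≠ 0) ∧ x i = u ∧ x l = v := by
    refine ⟨Function.update (Function.update
      (fun j => stdHilbertBasis 𝕜 (ι j) (hι j).some) i u) l v, fun j => ?_, ?_, ?_⟩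
    · rcases eq_or_ne j l with rfl | hjl
      · simpa using hv0
      · rw [Function.update_of_ne hjl]
        rcases eq_or_ne j i with rfl | hji
        · simpa using hu0
        · rw [Function.update_of_ne hji]
          exact (stdHilbertBasis 𝕜 (ι j)).orthonormal.ne_zero _
    · rw [Function.update_of_ne hil, Function.update_self]
    · rw [Function.update_self]
  have htprod_zero : ∀ {w : ∀ j, H j} (j : κ), w j = 0 → HilbertTensor.tprod 𝕜 w = 0 :=
    fun {w} j hj => by
      rw [← norm_eq_zero, HilbertTensor.norm_tprod]
      exact Finset.prod_eq_zero (Finset.mem_univ j) (by rw [hj, norm_zero])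
  have hWx : (HilbertTensor.map T + HilbertTensor.map S) (HilbertTensor.tprod 𝕜 x) = 0 := by
    rw [add_apply, HilbertTensor.map_tprod, HilbertTensor.map_tprod,
      htprod_zero i (by rw [hxi, hu]), htprod_zero l (by rw [hxl, hv]), add_zero]
  rw [hW, ContinuousLinearEquiv.coe_coe, map_eq_zero_iff _ (ContinuousLinearEquiv.injective _),
    ← norm_eq_zero, HilbertTensor.norm_tprod, Finset.prod_eq_zero_iff] at hWx
  obtain ⟨j, -, hj⟩ := hWx
  exact hx j (norm_eq_zero.1 hj)

end

/-! ### The main theorem -/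

theorem corollary3p3 {𝕜 : Type*} [RCLike 𝕜] {d : ℕ} (hd : 1 < d) {H : Fin d → Type*}
    [∀ j, NormedAddCommGroup (H j)] [∀ j, InnerProductSpace 𝕜 (H j)] [∀ j, CompleteSpace (H j)]
    [∀ j, TopologicalSpace.SeparableSpace (H j)]
    {ι : Fin d → Type*} [∀ j, Countable (ι j)]
    (f : ∀ j, Fin 2 → ι j → H j)
    (hf : ∀ j, LinearIndependent 𝕜 (f j)) :
    (IsFrame 𝕜 (tensorFamily 𝕜 (fun j => f j 0) + tensorFamily 𝕜 (fun j => f j 1)) →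
      IsFrame 𝕜 (tensorFamily 𝕜 fun j => f j 0) ∨
      IsFrame 𝕜 (tensorFamily 𝕜 fun j => f j 1) ∨
      ∃ i, ∀ k, ∀ j, j ≠ i → IsFrame 𝕜 (f j k)) ∧
    (IsRieszBasis 𝕜 (tensorFamily 𝕜 (fun j => f j 0) + tensorFamily 𝕜 (fun j => f j 1)) →
      (∀ j k, IsFrame 𝕜 (f j k)) →
      IsRieszBasis 𝕜 (tensorFamily 𝕜 fun j => f j 0) ∨
      IsRieszBasis 𝕜 (tensorFamily 𝕜 fun j => f j 1) ∨
      ∃ i, ∀ k, ∀ j, j ≠ i → IsRieszBasis 𝕜 (f j k)) := by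
  have hfg : ∀ j, LinearIndependent 𝕜 ![f j 0, f j 1] := fun j => by
    rw [show ![f j 0, f j 1] = f j from funext fun k => by fin_cases k <;> rfl]
    exact hf j
  refine ⟨fun h => ?_, fun h hframe => ?_⟩
  · refine (exists_forall_ne_of_forall_ne_or fun i l hil =>
      h.left_or_right_of_tensorFamily_add hfg hil).imp isFrame_tensorFamily
        (.imp isFrame_tensorFamily ?_)
    rintro ⟨i, hi⟩
    exact ⟨i, fun k j hj => by fin_cases k; exacts [(hi j hj).1, (hi j hj).2]⟩
  · have hι : ∀ j, Nonempty (ι j) := fun j => ⟨(hfg j).exists_ne_zero.choose⟩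
    refine (exists_forall_ne_of_forall_ne_or fun i l hil =>
      h.left_or_right_of_tensorFamily_add (fun j => hframe j 0) (fun j => hframe j 1) hι hil).imp
        isRieszBasis_tensorFamily (.imp isRieszBasis_tensorFamily ?_)
    rintro ⟨i, hi⟩
    exact ⟨i, fun k j hj => by fin_cases k; exacts [(hi j hj).1, (hi j hj).2]⟩
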